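/- Let $H$ be an infinite-dimensional separable complex Hilbert space with inner product $(\cdot,\cdot)$. Let $H^1\subset H$ be a dense subspace and let $\mathbf a[\cdot,\cdot]$ be a Hermitian sesquilinear form on $H^1$ whose quadratic form $\mathbf a[u]=\mathbf a[u,u]$ is closed and positive, i.e. $\mathbf a[u]\ge c\|u\|^2$ for all $u\in H^1$ with some constant $c>0$. Regard $H^1$ as a Hilbert space with the inner product $\mathbf a[\cdot,\cdot]$, and let $H^1_0$ be a closed subspace of $H^1$ that is dense in $H$. Let $A_{\mathrm N}$ and $A_{\mathrm D}$ be the self-adjoint operators in $H$ generated by the form $\mathbf a$ on $H^1$ and by its restriction to $H_0^1$, respectively. Let $E_{\mathrm N}(\lambda)$ and $E_{\mathrm D}(\lambda)$ be the orthogonal projections in $H$ onto $\ker(A_{\mathrm N}-\lambda I)$ and $\ker(A_{\mathrm D}-\lambda I)$. Denote by $\sigma_{\mathrm{ess}}(T)$ the essential spectrum of a self-adjoint operator $T$, that is, the set of $z$ for which $T-zI$ is not a Fredholm operator. Let $H^1_A$ be the set of $u\in H^1$ such that the functional $v\mapsto \mathbf a[u,v]$ on $H^1_0$ is continuous with respect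 to the norm of $H$, and let $A:H^1_A\to H$ be the operator defined by $(Au,v)=\mathbf a[u,v]$ for all $v\in H_0^1$. For $\lambda\in\mathbb R$ let $G_\lambda=\{u\in H^1_A: Au=\lambda u\}$, which is a closed subspace of $H^1$, let $\Pi'_\lambda$ be the $H^1$-orthogonal projection onto $G_\lambda$, and let $$\mathcal B_\lambda=(I-\lambda\,\Pi'_\lambda A_{\mathrm N}^{-1})\big|_{G_\lambda},$$ a bounded self-adjoint operator in the Hilbert space $G_\lambda$ with the inner product $\mathbf a[\cdot,\cdot]$. Then for every $\lambda\in\mathbb R$: 1. if $\lambda\notin\sigma_{\mathrm{ess}}(A_{\mathrm N})\cap\sigma_{\mathrm{ess}}(A_{\mathrm D})$, then $\ker\mathcal B_\lambda=E_{\mathrm D}(\lambda)H+E_{\mathrm N}(\lambda)H$; 2. if $\lambda\notin\sigma_{\mathrm{ess}}(A_{\mathrm N})\cup\sigma_{\mathrm{ess}}(A_{\mathrm D})$, then $0\notin\sigma_{\mathrm{ess}}(\mathcal B_\lambda)$. -/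

import Mathlib

open Filter Topology

-- so that `inner ℂ x y` unfolds to the inner product of the `InnerProductSpace` instance directly
attribute [-instance] WithCStarModule.instCStarModuleComplex

noncomputable section

/-- The eigenspace `ker (T - z I)` of a (possibly unbounded) operator `T` in `H`. -/
def opKer {H : Type*} [AddCommGroup H] [Module ℂ H] (T : H →ₗ.[ℂ] H) (z : ℂ) :
    Submodule ℂ H :=
  (LinearMap.ker (T.toFun - z • T.domain.subtype)).map T.domain.subtype

/-- The range of `T - z I`. -/
def opRange {H : Type*} [AddCommGroup H] [Module ℂ H] (T : H →ₗ.[ℂ] H) (z : ℂ) :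
    Submodule ℂ H :=
  LinearMap.range (T.toFun - z • T.domain.subtype)

/-- The essential spectrum of a (possibly unbounded, in practice self-adjoint) operator `T`: all `z` such that `T - z I` is not a Fredholm operator, where Fredholm means finite-dimensional
kernel, closed range and finite-dimensional cokernel. -/
def essSpectrum {H : Type*} [NormedAddCommGroup H] [NormedSpace ℂ H] (T : H →ₗ.[ℂ] H) : Set ℂ :=
  {z | ¬ (FiniteDimensional ℂ (opKer T z) ∧ IsClosed (opRange T z : Set H) ∧
    FiniteDimensional ℂ (H ⧸ opRange T z))}

/-- A densely defined, closed, positive (that is, bounded below by a positive constant)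
quadratic form in `H`, given by its sesquilinear form, conjugate linear in the first variable. -/
structure ClosedPositiveForm (H : Type*) [NormedAddCommGroup H] [InnerProductSpace ℂ H] where
  /-- the form domain -/
  domain : Submodule ℂ H
  dense_domain : Dense (domain : Set H)
  /-- the sesquilinear form -/
  form : domain →ₗ⋆[ℂ] domain →ₗ[ℂ] ℂ
  hermitian : ∀ u v, starRingEnd ℂ (form u v) = form v u
  positive : ∃ c : ℝ, 0 < c ∧ ∀ u : domain, c * ‖(u : H)‖ ^ 2 ≤ (form u u).re
  closed : ∀ (u : ℕ → domain) (x : H), Tendsto (fun n => (u n : H)) atTop (𝓝 x) →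
    (∀ ε > 0, ∃ N, ∀ m ≥ N, ∀ n ≥ N, (form (u m - u n) (u m - u n)).re < ε) →
    ∃ w : domain, (w : H) = x ∧ Tendsto (fun n => (form (u n - w) (u n - w)).re) atTop (𝓝 0)

namespace ClosedPositiveForm

variable {H : Type*} [NormedAddCommGroup H] [InnerProductSpace ℂ H]

/-- The inner product `a[·,·]` on the form domain. -/
@[reducible] def core (a : ClosedPositiveForm H) : InnerProductSpace.Core ℂ a.domain where
  inner u v := a.form u v
  conj_inner_symm u v := a.hermitian v u
  re_inner_nonneg u := by
    obtain ⟨c, hc, h⟩ := a.positive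
    exact le_trans (by positivity) (h u)
  add_left u v w := LinearMap.congr_fun (a.form.map_add u v) w
  smul_left u v r := LinearMap.congr_fun (a.form.map_smulₛₗ r u) v
  definite u hu := by
    obtain ⟨c, hc, h⟩ := a.positive
    have h1 := h u
    rw [hu, Complex.zero_re] at h1
    have h2 : ‖(u : H)‖ ^ 2 ≤ 0 := nonpos_of_mul_nonpos_right h1 hc
    have h3 : ‖(u : H)‖ = 0 :=
      (pow_eq_zero_iff two_ne_zero).mp (le_antisymm h2 (sq_nonneg _))
    exact Subtype.ext (norm_eq_zero.mp h3)

/-- The form domain `H¹`, regarded as a Hilbert space with inner product `a[·,·]`. -/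
def H1 (a : ClosedPositiveForm H) : Type _ := a.domain

instance (a : ClosedPositiveForm H) : NormedAddCommGroup a.H1 :=
  @InnerProductSpace.Core.toNormedAddCommGroup ℂ a.domain _ _ _ a.core

instance (a : ClosedPositiveForm H) : InnerProductSpace ℂ a.H1 :=
  @InnerProductSpace.ofCore ℂ a.domain _ _ _ a.core.toCore

theorem inner_H1 (a : ClosedPositiveForm H) (u v : a.domain) :
    inner ℂ (show a.H1 from u) (show a.H1 from v) = a.form u v := rfl

theorem norm_sq_H1 (a : ClosedPositiveForm H) (u : a.H1) :
    ‖u‖ ^ 2 = (a.form u u).re := by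
  rw [@norm_sq_eq_re_inner ℂ]; rfl

/-- The inclusion of `H¹` into `H`. -/
def incl (a : ClosedPositiveForm H) : a.H1 →L[ℂ] H :=
  LinearMap.mkContinuousOfExistsBound (show a.H1 →ₗ[ℂ] H from a.domain.subtype) (by
    obtain ⟨c, hc, h⟩ := a.positive
    refine ⟨(Real.sqrt c)⁻¹, fun u => ?_⟩
    have h1 := h u
    rw [← norm_sq_H1] at h1
    have hs : 0 < Real.sqrt c := Real.sqrt_pos.mpr hc
    rw [inv_mul_eq_div, le_div_iff₀ hs]
    refine le_of_sq_le_sq ?_ (norm_nonneg _)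
    rw [mul_pow, Real.sq_sqrt hc.le, mul_comm]
    exact h1)

theorem incl_apply (a : ClosedPositiveForm H) (u : a.domain) :
    a.incl (show a.H1 from u) = (u : H) := rfl

instance [CompleteSpace H] (a : ClosedPositiveForm H) : CompleteSpace a.H1 := by
  refine Metric.complete_of_cauchySeq_tendsto fun u hu => ?_
  obtain ⟨x, hx⟩ := cauchySeq_tendsto_of_complete (a.incl.uniformContinuous.comp_cauchySeq hu)
  obtain ⟨w, -, hw⟩ := a.closed u x hx (fun ε hε => by
    obtain ⟨N, hN⟩ := Metric.cauchySeq_iff.mp hu (Real.sqrt ε) (Real.sqrt_pos.mpr hε)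
    refine ⟨N, fun m hm n hn => ?_⟩
    have h1 := hN m hm n hn
    rw [dist_eq_norm] at h1
    have h2 := a.norm_sq_H1 (u m - u n)
    have h3 : ‖u m - u n‖ ^ 2 < ε := by
      rw [← Real.sq_sqrt hε.le]
      exact pow_lt_pow_left₀ h1 (norm_nonneg _) two_ne_zero
    rw [h2] at h3
    exact h3)
  refine ⟨w, tendsto_iff_norm_sub_tendsto_zero.mpr ?_⟩
  have h1 : Tendsto (fun n => ‖u n - (show a.H1 from w)‖ ^ 2) atTop (𝓝 0) := by
    refine hw.congr fun n => ?_
    rw [a.norm_sq_H1]; rfl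
  have h2 := h1.sqrt
  simpa [Real.sqrt_sq] using h2

/-- A subspace `H¹₀` of `H¹` that is closed in `H¹` and dense in `H`. -/
structure DenseClosedSubspace (a : ClosedPositiveForm H) where
  /-- the subspace `H¹₀` -/
  toSubmodule : Submodule ℂ a.H1
  isClosed : IsClosed (toSubmodule : Set a.H1)
  dense : Dense (a.incl '' (toSubmodule : Set a.H1))

/-- The whole space `H¹`, regarded as such a subspace. -/
def whole (a : ClosedPositiveForm H) : a.DenseClosedSubspace where
  toSubmodule := ⊤
  isClosed := isClosed_univ
  dense := by
    have h : a.incl '' ((⊤ : Submodule ℂ a.H1) : Set a.H1) = (a.domain : Set H) := by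
      ext x
      constructor
      · rintro ⟨u, -, rfl⟩
        exact (show a.domain from u).2
      · intro hx
        exact ⟨(show a.H1 from ⟨x, hx⟩), trivial, rfl⟩
    rw [h]
    exact a.dense_domain

/-- All pairs `(u, f)` with `u ∈ U` and `(f, v) = a[u, v]` for all `v ∈ W`. -/
def formGraph (a : ClosedPositiveForm H) (U W : Submodule ℂ a.H1) : Submodule ℂ (H × H) where
  carrier := {p | ∃ u ∈ U, a.incl u = p.1 ∧ ∀ v ∈ W, inner ℂ p.2 (a.incl v) = inner ℂ u v}
  zero_mem' := ⟨0, U.zero_mem, by simp, by simp⟩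
  add_mem' := by
    rintro _ _ ⟨u, hu, hu1, hu2⟩ ⟨u', hu', hu1', hu2'⟩
    refine ⟨u + u', U.add_mem hu hu', by simp [hu1, hu1'], fun v hv => ?_⟩
    simp [inner_add_left, hu2 v hv, hu2' v hv]
  smul_mem' := by
    rintro c _ ⟨u, hu, hu1, hu2⟩
    refine ⟨c • u, U.smul_mem c hu, by simp [hu1], fun v hv => ?_⟩
    simp [inner_smul_left, hu2 v hv]

/-- The operator `u ↦ f` in `H` whose graph is `formGraph U W` (for `W` dense in `H`): its domain
consists of those `u ∈ U` for which the functional `v ↦ a[u, v]` on `W` is `H`-continuous, see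
`mem_domain_formOp_iff`. -/
def formOp (a : ClosedPositiveForm H) (U : Submodule ℂ a.H1) (W : a.DenseClosedSubspace) :
    H →ₗ.[ℂ] H :=
  (a.formGraph U W.toSubmodule).toLinearPMap

theorem graph_formOp (a : ClosedPositiveForm H) (U : Submodule ℂ a.H1)
    (W : a.DenseClosedSubspace) : (a.formOp U W).graph = a.formGraph U W.toSubmodule := by
  refine Submodule.toLinearPMap_graph_eq _ ?_
  rintro ⟨x, f⟩ ⟨u, -, hu1, hu2⟩ hx
  simp only at hx hu1 hu2 ⊢
  have hu0 : u = 0 := Subtype.ext (hu1.trans hx)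
  refine W.dense.eq_zero_of_inner_left ℂ fun y hy => ?_
  obtain ⟨v, hv, rfl⟩ := hy
  simpa [hu0] using hu2 v hv

theorem mem_domain_formOp_iff [CompleteSpace H] (a : ClosedPositiveForm H)
    (U : Submodule ℂ a.H1) (W : a.DenseClosedSubspace) (x : H) :
    x ∈ (a.formOp U W).domain ↔ ∃ u ∈ U, a.incl u = x ∧
      ∃ C : ℝ, ∀ v ∈ W.toSubmodule, ‖(inner ℂ u v : ℂ)‖ ≤ C * ‖a.incl v‖ := by
  have hinj : Function.Injective (a.incl : a.H1 →ₗ[ℂ] H) := Subtype.val_injective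
  change x ∈ (a.formGraph U W.toSubmodule).map (LinearMap.fst ℂ H H) ↔ _
  constructor
  · rintro ⟨⟨x, f⟩, ⟨u, hu, hux, h⟩, rfl⟩
    refine ⟨u, hu, hux, ‖f‖, fun v hv => ?_⟩
    rw [← h v hv]
    exact norm_inner_le_norm _ _
  · rintro ⟨u, hu, rfl, C, hC⟩
    let e := Submodule.equivMapOfInjective _ hinj W.toSubmodule
    let g : (W.toSubmodule.map (a.incl : a.H1 →ₗ[ℂ] H)) →ₗ[ℂ] ℂ :=
      ((innerSL ℂ u : a.H1 →L[ℂ] ℂ) : a.H1 →ₗ[ℂ] ℂ) ∘ₗ W.toSubmodule.subtype ∘ₗ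
        (e.symm : _ →ₗ[ℂ] W.toSubmodule)
    have hg : ∀ y, ‖g y‖ ≤ C * ‖y‖ := fun y => by
      have h1 := hC _ (e.symm y).2
      have h2 : a.incl (e.symm y : a.H1) = (y : H) :=
        (Submodule.coe_equivMapOfInjective_apply _ hinj W.toSubmodule (e.symm y)).symm.trans
          (congrArg Subtype.val (e.apply_symm_apply y))
      rw [h2] at h1
      exact h1
    obtain ⟨G, hG, -⟩ := exists_extension_norm_eq _ (g.mkContinuous C hg)
    refine ⟨(a.incl u, (InnerProductSpace.toDual ℂ H).symm G), ⟨u, hu, rfl, fun v hv => ?_⟩, rfl⟩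
    rw [InnerProductSpace.toDual_symm_apply]
    have h1 := hG (e ⟨v, hv⟩)
    rw [Submodule.coe_equivMapOfInjective_apply] at h1
    refine h1.trans ?_
    change inner ℂ u (e.symm (e ⟨v, hv⟩) : a.H1) = _
    rw [e.symm_apply_apply]

/-- The "Neumann" operator `A_N`, generated by the form `a` on `H¹`. -/
def neumann (a : ClosedPositiveForm H) : H →ₗ.[ℂ] H := a.formOp ⊤ a.whole

/-- The inverse of `A_N` as an operator from `H` to `H¹`, characterised by
`a[A_N⁻¹ f, v] = (f, v)` for all `v ∈ H¹`. -/
def neumannInv [CompleteSpace H] (a : ClosedPositiveForm H) : H →L[ℂ] a.H1 :=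
  ContinuousLinearMap.adjoint a.incl

namespace DenseClosedSubspace

variable {a : ClosedPositiveForm H}

/-- The "Dirichlet" operator `A_D`, generated by the restriction of the form `a` to `H¹₀`. -/
def dirichlet (V : a.DenseClosedSubspace) : H →ₗ.[ℂ] H := a.formOp V.toSubmodule V

/-- The operator `A` on `H¹_A ⊆ H¹`, given by `(A u, v) = a[u, v]` for all `v ∈ H¹₀`. -/
def opA (V : a.DenseClosedSubspace) : H →ₗ.[ℂ] H := a.formOp ⊤ V

/-- `G_z = {u ∈ H¹_A : A u = z u}`, as a subspace of the Hilbert space `H¹`. -/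
def G (V : a.DenseClosedSubspace) (z : ℂ) : Submodule ℂ a.H1 :=
  (opKer V.opA z).comap (a.incl : a.H1 →ₗ[ℂ] H)

end DenseClosedSubspace

theorem mem_opKer_iff {T : H →ₗ.[ℂ] H} {z : ℂ} {x : H} :
    x ∈ opKer T z ↔ (x, z • x) ∈ T.graph := by
  rw [LinearPMap.mem_graph_iff, opKer, Submodule.mem_map]
  constructor
  · rintro ⟨y, hy, rfl⟩
    exact ⟨y, rfl, by simpa [sub_eq_zero] using hy⟩
  · rintro ⟨y, rfl, hy⟩
    exact ⟨y, by simpa [sub_eq_zero] using hy, rfl⟩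

theorem DenseClosedSubspace.mem_dirichlet_graph_iff [CompleteSpace H] {a : ClosedPositiveForm H}
    (V : a.DenseClosedSubspace) [V.toSubmodule.HasOrthogonalProjection] (x f : H) :
    (x, f) ∈ V.dirichlet.graph ↔
      x = a.incl (V.toSubmodule.starProjection (a.neumannInv f)) := by
  rw [dirichlet, graph_formOp]
  constructor
  · rintro ⟨u, hu, rfl, h⟩
    congr 1
    refine (Submodule.eq_starProjection_of_mem_of_inner_eq_zero hu fun v hv => ?_).symm
    simp only at h
    rw [inner_sub_left, neumannInv, ContinuousLinearMap.adjoint_inner_left, h v hv, sub_self]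
  · rintro rfl
    refine ⟨_, Submodule.starProjection_apply_mem _ _, rfl, fun v hv => ?_⟩
    have := Submodule.starProjection_inner_eq_zero (K := V.toSubmodule) (a.neumannInv f) v hv
    rw [inner_sub_left, neumannInv, ContinuousLinearMap.adjoint_inner_left, sub_eq_zero] at this
    exact this

theorem neumann_eq (a : ClosedPositiveForm H) : a.neumann = a.whole.dirichlet := rfl

/-- `neumannInv` is indeed the inverse of `A_N`. -/
theorem mem_neumann_graph_iff [CompleteSpace H] (a : ClosedPositiveForm H) (x f : H) :
    (x, f) ∈ a.neumann.graph ↔ x = a.incl (a.neumannInv f) := by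
  have : a.whole.toSubmodule.HasOrthogonalProjection :=
    inferInstanceAs (⊤ : Submodule ℂ a.H1).HasOrthogonalProjection
  rw [neumann_eq, DenseClosedSubspace.mem_dirichlet_graph_iff]
  have h : a.whole.toSubmodule.starProjection (a.neumannInv f) = a.neumannInv f :=
    Submodule.starProjection_eq_self_iff.mpr trivial
  rw [h]

namespace DenseClosedSubspace

variable {a : ClosedPositiveForm H}

instance [CompleteSpace H] (V : a.DenseClosedSubspace) (z : ℂ) :
    (opKer V.dirichlet z).HasOrthogonalProjection := by
  have : CompleteSpace V.toSubmodule := V.isClosed.completeSpace_coe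
  have h : IsClosed (opKer V.dirichlet z : Set H) := by
    have : (opKer V.dirichlet z : Set H) =
        {x | x = a.incl (V.toSubmodule.starProjection (a.neumannInv (z • x)))} := by
      ext x
      rw [SetLike.mem_coe, mem_opKer_iff, mem_dirichlet_graph_iff]
      rfl
    rw [this]
    exact isClosed_eq continuous_id (by fun_prop)
  have := h.completeSpace_coe
  infer_instance

instance [CompleteSpace H] (z : ℂ) : (opKer a.neumann z).HasOrthogonalProjection :=
  inferInstanceAs (opKer a.whole.dirichlet z).HasOrthogonalProjection

theorem mem_G_iff (V : a.DenseClosedSubspace) (z : ℂ) (u : a.H1) :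
    u ∈ V.G z ↔ ∀ v ∈ V.toSubmodule, inner ℂ (z • a.incl u) (a.incl v) = inner ℂ u v := by
  rw [G, Submodule.mem_comap, mem_opKer_iff, opA, graph_formOp]
  constructor
  · rintro ⟨w, -, hw, h⟩
    have : w = u := Subtype.ext hw
    subst this
    exact h
  · intro h
    exact ⟨u, trivial, rfl, h⟩

instance [CompleteSpace H] (V : a.DenseClosedSubspace) (z : ℂ) :
    (V.G z).HasOrthogonalProjection := by
  have h : IsClosed (V.G z : Set a.H1) := by
    have : (V.G z : Set a.H1) = ⋂ v ∈ V.toSubmodule,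
        {u | (inner ℂ (z • a.incl u) (a.incl v) : ℂ) = inner ℂ u v} := by
      ext u
      simp [mem_G_iff]
    rw [this]
    exact isClosed_biInter fun v _ => isClosed_eq (by fun_prop) (by fun_prop)
  have := h.completeSpace_coe
  infer_instance

/-- `E_D(z)`, the orthogonal projection in `H` onto `ker (A_D - z I)`. -/
def ED [CompleteSpace H] (V : a.DenseClosedSubspace) (z : ℂ) : H →L[ℂ] H :=
  (opKer V.dirichlet z).starProjection

end DenseClosedSubspace

/-- `E_N(z)`, the orthogonal projection in `H` onto `ker (A_N - z I)`. -/
def EN [CompleteSpace H] (a : ClosedPositiveForm H) (z : ℂ) : H →L[ℂ] H :=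
  (opKer a.neumann z).starProjection

namespace DenseClosedSubspace

variable {a : ClosedPositiveForm H}

/-- `Π'_lam`, the `H¹`-orthogonal projection onto `G_lam`. -/
def projG [CompleteSpace H] (V : a.DenseClosedSubspace) (lam : ℝ) : a.H1 →L[ℂ] V.G lam :=
  (V.G lam).orthogonalProjectionOnto

/-- `B_lam`, the restriction of `I - lam Π'_lam A_N⁻¹` to `G_lam`, as an operator in the Hilbert
space `G_lam` (with the inner product `a[·,·]`). -/
def B [CompleteSpace H] (V : a.DenseClosedSubspace) (lam : ℝ) : V.G lam →L[ℂ] V.G lam :=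
  ContinuousLinearMap.id ℂ (V.G lam) -
    (lam : ℂ) • (V.projG lam ∘L a.neumannInv ∘L a.incl ∘L (V.G lam).subtypeL)

/-- `G⁰_lam = ker B_lam`, as a subspace of `H`. -/
def G0 [CompleteSpace H] (V : a.DenseClosedSubspace) (lam : ℝ) : Submodule ℂ H :=
  (LinearMap.ker (V.B lam : V.G lam →ₗ[ℂ] V.G lam)).map
    ((a.incl : a.H1 →ₗ[ℂ] H) ∘ₗ (V.G lam).subtype)

/-- The essential spectrum of the bounded operator `B_lam` in `G_lam`. -/
def essSpectrumB [CompleteSpace H] (V : a.DenseClosedSubspace) (lam : ℝ) : Set ℂ :=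
  essSpectrum ((V.B lam : V.G lam →ₗ[ℂ] V.G lam).toPMap ⊤)

end DenseClosedSubspace

end ClosedPositiveForm

end

/-! Everything reduces to bounded operators in `H¹`. Put `S = I - lam A_N⁻¹` (`a.whole.pencil`), so
`a[Su, v] = a[u, v] - lam (u, v)`, and let `P` be the `H¹`-projection onto `V = H¹₀`. Then `G = {u |
Su ⊥ V} = (SV)ᗮ`, and `B` is the compression of the self-adjoint `S` to `G`. Hence `Bu = 0` iff `Su
∈ Gᗮ`, the closure of `SV`.

If `SV` is closed, then `Su = Sv` with `v ∈ V`; so `v ∈ G ∩ V` is a Dirichlet eigenvector and `u - v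
∈ ker S` a Neumann one. Closedness (`orthogonal_G`) needs only one Fredholm condition: either `S`
itself, or `PS`, which on `V` equals `V.pencil`, is bounded below modulo a finite-dimensional space
(`isClosed_map_of_eqOn_comp`).

Under both conditions the kernel of `B` is finite-dimensional by the first part, and `Bu = g` is
solved for `g` in a subspace of finite codimension by combining a Neumann and a Dirichlet solution
(`cofg_range_B`). -/

namespace Submodule

theorem CoFG.comap {R M N : Type*} [Ring R] [IsNoetherianRing R] [AddCommGroup M] [Module R M]
    [AddCommGroup N] [Module R N] {S : Submodule R N} (hS : S.CoFG) (f : M →ₗ[R] N) :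
    (S.comap f).CoFG := by
  have : IsNoetherian R (N ⧸ S) := isNoetherian_of_isNoetherianRing_of_finite R _
  have h : S.comap f = LinearMap.ker (S.mkQ ∘ₗ f) := by
    rw [LinearMap.ker_comp, ker_mkQ]
  rw [h]
  exact CoFG.ker _

end Submodule

/-! ### Closed images under Fredholm operators -/

namespace ContinuousLinearMap

variable {K : Type*} [NormedAddCommGroup K] [InnerProductSpace ℂ K] [CompleteSpace K]

/-- An operator with finite-dimensional kernel and cokernel is bounded below on the orthogonal
complement of its kernel. -/
theorem exists_norm_le_mul_norm_of_mem_ker_orthogonal (T : K →L[ℂ] K)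
    [FiniteDimensional ℂ T.ker] (hT : T.range.CoFG) :
    ∃ C : ℝ, ∀ x ∈ T.kerᗮ, ‖x‖ ≤ C * ‖T x‖ := by
  let f : T.kerᗮ →L[ℂ] K := T ∘L T.kerᗮ.subtypeL
  have hker : f.ker = ⊥ := by
    rw [LinearMap.ker_eq_bot']
    intro x hx
    have : (x : K) ∈ T.ker ⊓ T.kerᗮ := ⟨hx, x.2⟩
    rw [Submodule.inf_orthogonal_eq_bot] at this
    exact Subtype.ext this
  have hrange : f.range = T.range := by
    refine le_antisymm ?_ ?_
    · rintro _ ⟨x, rfl⟩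
      exact ⟨x, rfl⟩
    · rintro _ ⟨x, rfl⟩
      refine ⟨⟨x - T.ker.starProjection x, T.ker.sub_starProjection_mem_orthogonal x⟩, ?_⟩
      have h0 : T (T.ker.starProjection x) = 0 := Submodule.starProjection_apply_mem T.ker x
      simp [f, h0]
  -- A range with a closed complement is closed; an injective operator with closed range is bounded
  -- below.
  obtain ⟨E, hE⟩ := Submodule.exists_isCompl T.range
  have : FiniteDimensional ℂ E := .of_fg (Submodule.CoFG.fg_of_isCompl hE hT)
  have hclosed : IsClosed (f.range : Set K) :=
    f.closed_complemented_range_of_isCompl_of_ker_eq_bot E (hrange ▸ hE)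
      E.closed_of_finiteDimensional hker
  obtain ⟨C, hC⟩ := f.antilipschitz_of_injective_of_isClosed_range
    (LinearMap.ker_eq_bot.mp hker) (by rwa [LinearMap.coe_range] at hclosed)
  refine ⟨C, fun x hx => ?_⟩
  simpa [f] using hC.le_mul_dist (⟨x, hx⟩ : T.kerᗮ) 0

/-- If `Q ∘ L` agrees on a closed subspace `V` with an operator that has finite-dimensional kernel
and cokernel, then `L` maps `V` onto a closed subspace. -/
theorem isClosed_map_of_eqOn_comp (T L Q : K →L[ℂ] K) [FiniteDimensional ℂ T.ker]
    (hT : T.range.CoFG) {V : Submodule ℂ K} (hV : IsClosed (V : Set K))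
    (h : ∀ v ∈ V, Q (L v) = T v) :
    IsClosed (V.map (L : K →ₗ[ℂ] K) : Set K) := by
  obtain ⟨C, hC⟩ := T.exists_norm_le_mul_norm_of_mem_ker_orthogonal hT
  have hcofg : (T.kerᗮ).CoFG :=
    Submodule.FG.cofg_of_isCompl T.ker.isCompl_orthogonal
      (Submodule.fg_iff_finiteDimensional _ |>.mpr inferInstance)
  have : (T.kerᗮ.comap V.subtype).CoFG := hcofg.comap _
  have hclosed : IsClosed ((V ⊓ T.kerᗮ : Submodule ℂ K) : Set K) := by
    rw [Submodule.coe_inf]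
    exact hV.inter T.ker.isClosed_orthogonal
  have := hclosed.completeSpace_coe
  let f : (V ⊓ T.kerᗮ : Submodule ℂ K) →L[ℂ] K := L ∘L (V ⊓ T.kerᗮ).subtypeL
  -- On `V ⊓ T.kerᗮ`, `‖x‖ ≤ C ‖T x‖ = C ‖Q (L x)‖ ≤ C ‖Q‖ ‖L x‖`.
  have hf : AntilipschitzWith (C.toNNReal * ‖Q‖₊) f := by
    refine f.antilipschitz_of_bound fun x => ?_
    have h1 := hC x x.2.2
    rw [← h x x.2.1] at h1
    calc ‖x‖ ≤ C * ‖Q (L x)‖ := h1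
      _ ≤ C.toNNReal * (‖Q‖ * ‖L x‖) := by
        gcongr
        · exact Real.le_coe_toNNReal C
        · exact Q.le_opNorm _
      _ = _ := by rw [NNReal.coe_mul, coe_nnnorm, mul_assoc]; rfl
  have hmap : IsClosed ((T.kerᗮ.comap V.subtype).map ((L : K →ₗ[ℂ] K) ∘ₗ V.subtype) : Set K) := by
    rw [Submodule.map_comp, Submodule.map_comap_subtype]
    have h2 := hf.isClosed_range f.uniformContinuous
    convert h2 using 1
    ext y
    simp [f]
  -- `V ⊓ T.kerᗮ` has finite codimension in `V`, so the full image adds only finitely many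
  -- dimensions to a closed subspace.
  have := LinearMap.isClosed_range_of_isClosed_map_of_finiteDimensional_quotient hmap
  rwa [LinearMap.range_comp, Submodule.range_subtype] at this

end ContinuousLinearMap

namespace ClosedPositiveForm

variable {H : Type*} [NormedAddCommGroup H] [InnerProductSpace ℂ H]

theorem incl_injective (a : ClosedPositiveForm H) : Function.Injective a.incl :=
  Subtype.val_injective

variable [CompleteSpace H] {a : ClosedPositiveForm H}

/-! ### Pencils in `H¹` and the spectra of `A_D`, `A_N` -/

namespace DenseClosedSubspace

instance (V : a.DenseClosedSubspace) : V.toSubmodule.HasOrthogonalProjection :=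
  have : CompleteSpace V.toSubmodule := V.isClosed.completeSpace_coe
  inferInstance

/-- The operator `I - z P A_N⁻¹` in `H¹`, where `P` is the orthogonal projection onto `V`. -/
noncomputable def pencil (V : a.DenseClosedSubspace) (z : ℂ) : a.H1 →L[ℂ] a.H1 :=
  ContinuousLinearMap.id ℂ a.H1 - z • (V.toSubmodule.starProjection ∘L a.neumannInv ∘L a.incl)

theorem pencil_apply (V : a.DenseClosedSubspace) (z : ℂ) (u : a.H1) :
    V.pencil z u = u - z • V.toSubmodule.starProjection (a.neumannInv (a.incl u)) := rfl

theorem whole_pencil_apply (z : ℂ) (u : a.H1) :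
    a.whole.pencil z u = u - z • a.neumannInv (a.incl u) := by
  have h : a.whole.toSubmodule.starProjection (a.neumannInv (a.incl u)) =
      a.neumannInv (a.incl u) := Submodule.starProjection_eq_self_iff.mpr trivial
  rw [pencil_apply, h]

theorem starProjection_whole_pencil (V : a.DenseClosedSubspace) (z : ℂ) (u : a.H1) :
    V.toSubmodule.starProjection (a.whole.pencil z u) =
      V.toSubmodule.starProjection u - u + V.pencil z u := by
  rw [whole_pencil_apply, pencil_apply, map_sub, map_smul]
  abel

theorem starProjection_whole_pencil_of_mem (V : a.DenseClosedSubspace) (z : ℂ) {v : a.H1}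
    (hv : v ∈ V.toSubmodule) :
    V.toSubmodule.starProjection (a.whole.pencil z v) = V.pencil z v := by
  rw [starProjection_whole_pencil, Submodule.starProjection_eq_self_iff.mpr hv, sub_self, zero_add]

theorem mem_of_pencil_mem (V : a.DenseClosedSubspace) {z : ℂ} {u : a.H1}
    (hu : V.pencil z u ∈ V.toSubmodule) : u ∈ V.toSubmodule := by
  rw [pencil_apply] at hu
  exact (V.toSubmodule.sub_mem_iff_left
    (V.toSubmodule.smul_mem z (Submodule.starProjection_apply_mem _ _))).mp hu

theorem map_ker_pencil (V : a.DenseClosedSubspace) (z : ℂ) :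
    (V.pencil z).ker.map (a.incl : a.H1 →ₗ[ℂ] H) = opKer V.dirichlet z := by
  ext x
  rw [mem_opKer_iff, mem_dirichlet_graph_iff, Submodule.mem_map, map_smul, map_smul]
  constructor
  · rintro ⟨u, hu, rfl⟩
    refine congrArg a.incl (sub_eq_zero.mp ?_)
    exact hu
  · intro h
    refine ⟨_, ?_, h.symm⟩
    change V.pencil z _ = 0
    rw [pencil_apply, ← h, sub_self]

/-- Parametrising the domain of `A_D` by `f = A_D x` replaces the unbounded operator by a bounded
one. -/
theorem mem_opRange_dirichlet_iff (V : a.DenseClosedSubspace) (z : ℂ) (y : H) :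
    y ∈ opRange V.dirichlet z ↔
      ∃ f, f - z • a.incl (V.toSubmodule.starProjection (a.neumannInv f)) = y := by
  constructor
  · rintro ⟨x, rfl⟩
    refine ⟨V.dirichlet x, ?_⟩
    rw [← (V.mem_dirichlet_graph_iff _ _).mp (V.dirichlet.mem_graph x)]
    rfl
  · rintro ⟨f, rfl⟩
    obtain ⟨x, hx, hf⟩ := LinearPMap.mem_graph_iff _ |>.mp
      ((V.mem_dirichlet_graph_iff _ f).mpr rfl)
    exact ⟨x, congrArg₂ (fun p q : H => p - z • q) hf hx⟩

theorem finiteDimensional_ker_pencil (V : a.DenseClosedSubspace) {z : ℂ}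
    (hz : z ∉ essSpectrum V.dirichlet) : FiniteDimensional ℂ (V.pencil z).ker := by
  have h : FiniteDimensional ℂ (opKer V.dirichlet z) := (not_not.mp hz).1
  rw [← map_ker_pencil] at h
  exact (Submodule.equivMapOfInjective _ a.incl_injective (V.pencil z).ker).symm.finiteDimensional

/-- Solvability passes from `H` to `H¹`: if `g ∈ H¹` equals `f - z w` in `H` with `w = P A_N⁻¹ f`,
then `f = g + z w` lies in `H¹` and the pencil maps it to `g`. -/
theorem cofg_range_pencil (V : a.DenseClosedSubspace) {z : ℂ}
    (hz : z ∉ essSpectrum V.dirichlet) : (V.pencil z).range.CoFG := by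
  have h : (opRange V.dirichlet z).CoFG := (not_not.mp hz).2.2
  refine (h.comap (a.incl : a.H1 →ₗ[ℂ] H)).of_le fun g hg => ?_
  obtain ⟨f, hf⟩ := (V.mem_opRange_dirichlet_iff z _).mp hg
  set w := V.toSubmodule.starProjection (a.neumannInv f)
  have hf' : a.incl (g + z • w) = f := by
    rw [map_add, map_smul]
    exact (sub_eq_iff_eq_add.mp hf).symm
  refine ⟨g + z • w, ?_⟩
  change V.pencil z _ = g
  rw [pencil_apply, hf', add_sub_cancel_right]

/-! ### The space `G` and the kernel of `B` -/

theorem inner_whole_pencil (lam : ℝ) (u v : a.H1) :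
    inner ℂ (a.whole.pencil lam u) v = (inner ℂ u (a.whole.pencil lam v) : ℂ) := by
  rw [whole_pencil_apply, whole_pencil_apply, inner_sub_left, inner_sub_right, inner_smul_left,
    inner_smul_right, neumannInv, ContinuousLinearMap.adjoint_inner_left,
    ContinuousLinearMap.adjoint_inner_right, Complex.conj_ofReal]

theorem mem_G_iff_whole_pencil (V : a.DenseClosedSubspace) (lam : ℝ) (u : a.H1) :
    u ∈ V.G lam ↔ a.whole.pencil lam u ∈ V.toSubmoduleᗮ := by
  rw [mem_G_iff, Submodule.mem_orthogonal']
  refine forall₂_congr fun v _ => ?_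
  rw [whole_pencil_apply, inner_sub_left, inner_smul_left, inner_smul_left, neumannInv,
    ContinuousLinearMap.adjoint_inner_left, sub_eq_zero, eq_comm]

theorem mem_G_iff_mem_orthogonal_map (V : a.DenseClosedSubspace) (lam : ℝ) (u : a.H1) :
    u ∈ V.G lam ↔
      u ∈ (V.toSubmodule.map (a.whole.pencil lam : a.H1 →ₗ[ℂ] a.H1))ᗮ := by
  rw [mem_G_iff_whole_pencil, Submodule.mem_orthogonal', Submodule.mem_orthogonal']
  simp only [Submodule.mem_map, forall_exists_index, and_imp, forall_apply_eq_imp_iff₂]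
  refine forall₂_congr fun v _ => ?_
  rw [inner_whole_pencil]
  rfl

theorem G_eq_orthogonal_map (V : a.DenseClosedSubspace) (lam : ℝ) :
    V.G lam = (V.toSubmodule.map (a.whole.pencil lam : a.H1 →ₗ[ℂ] a.H1))ᗮ :=
  Submodule.ext (V.mem_G_iff_mem_orthogonal_map lam)

/-- On `V` the condition `Sv ⊥ V` reads `PSv = 0`, and `PS` is the Dirichlet pencil there. -/
theorem mem_G_iff_pencil_of_mem (V : a.DenseClosedSubspace) (lam : ℝ) {v : a.H1}
    (hv : v ∈ V.toSubmodule) : v ∈ V.G lam ↔ V.pencil lam v = 0 := by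
  rw [mem_G_iff_whole_pencil, ← Submodule.starProjection_apply_eq_zero_iff,
    starProjection_whole_pencil_of_mem V _ hv]

theorem B_apply (V : a.DenseClosedSubspace) (lam : ℝ) (u : V.G lam) :
    V.B lam u = V.projG lam (a.whole.pencil lam u) := by
  rw [whole_pencil_apply, map_sub, map_smul]
  have h : V.projG lam u = u := Submodule.orthogonalProjectionOnto_mem_subspace_eq_self u
  rw [h]
  rfl

theorem B_apply_eq_iff (V : a.DenseClosedSubspace) (lam : ℝ) (u g : V.G lam) :
    V.B lam u = g ↔ a.whole.pencil lam u - g ∈ (V.G lam)ᗮ := by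
  have h : V.projG lam g = g := Submodule.orthogonalProjectionOnto_mem_subspace_eq_self g
  rw [B_apply, ← sub_eq_zero]
  nth_rw 1 [← h]
  rw [← map_sub, projG, Submodule.orthogonalProjectionOnto_eq_zero_iff]

theorem map_whole_pencil_le_orthogonal_G (V : a.DenseClosedSubspace) (lam : ℝ) :
    V.toSubmodule.map (a.whole.pencil lam : a.H1 →ₗ[ℂ] a.H1) ≤ (V.G lam)ᗮ := by
  rw [G_eq_orthogonal_map]
  exact Submodule.le_orthogonal_orthogonal _

theorem orthogonal_G (V : a.DenseClosedSubspace) (lam : ℝ)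
    (h : (lam : ℂ) ∉ essSpectrum a.neumann ∩ essSpectrum V.dirichlet) :
    (V.G lam)ᗮ = V.toSubmodule.map (a.whole.pencil lam : a.H1 →ₗ[ℂ] a.H1) := by
  rw [G_eq_orthogonal_map, Submodule.orthogonal_orthogonal_eq_closure]
  refine IsClosed.submodule_topologicalClosure_eq ?_
  rw [Set.mem_inter_iff, not_and_or] at h
  rcases h with h | h
  -- Neumann case: `T = L = S`, `Q = I`.
  · have := a.whole.finiteDimensional_ker_pencil h
    exact ContinuousLinearMap.isClosed_map_of_eqOn_comp (a.whole.pencil lam) _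
      (ContinuousLinearMap.id ℂ a.H1) (a.whole.cofg_range_pencil h) V.isClosed fun _ _ => rfl
  -- Dirichlet case: `L = S`, `Q = P`, and `T` is the Dirichlet pencil.
  · have := V.finiteDimensional_ker_pencil h
    exact ContinuousLinearMap.isClosed_map_of_eqOn_comp (V.pencil lam) _
      V.toSubmodule.starProjection (V.cofg_range_pencil h) V.isClosed
      fun v hv => V.starProjection_whole_pencil_of_mem lam hv

theorem G0_eq_sup (V : a.DenseClosedSubspace) (lam : ℝ)
    (h : (lam : ℂ) ∉ essSpectrum a.neumann ∩ essSpectrum V.dirichlet) :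
    V.G0 lam = opKer V.dirichlet lam ⊔ opKer a.neumann lam := by
  rw [neumann_eq, ← map_ker_pencil, ← map_ker_pencil, ← Submodule.map_sup, G0,
    Submodule.map_comp]
  congr 1
  ext u
  rw [Submodule.mem_map, Submodule.mem_sup]
  constructor
  · rintro ⟨u, hu, rfl⟩
    have h1 := (V.B_apply_eq_iff lam u 0).mp hu
    rw [V.orthogonal_G lam h] at h1
    obtain ⟨v, hv, hvu⟩ := h1
    have hvu' : a.whole.pencil lam v = a.whole.pencil lam u := by simpa using hvu
    have hvG : v ∈ V.G lam := by
      rw [mem_G_iff_whole_pencil, hvu', ← mem_G_iff_whole_pencil]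
      exact u.2
    refine ⟨v, (V.mem_G_iff_pencil_of_mem lam hv).mp hvG, u - v, ?_, add_sub_cancel _ _⟩
    change a.whole.pencil lam (u - v) = 0
    rw [map_sub, hvu', sub_self]
  · rintro ⟨v, hv, w, hw, rfl⟩
    have hv0 : V.pencil lam v = 0 := hv
    have hw0 : a.whole.pencil lam w = 0 := hw
    have hvV : v ∈ V.toSubmodule := V.mem_of_pencil_mem (z := lam) (by simp [hv0])
    have hvG : v ∈ V.G lam := (V.mem_G_iff_pencil_of_mem lam hvV).mpr hv0
    have hwG : w ∈ V.G lam := by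
      rw [mem_G_iff_whole_pencil, hw0]
      exact zero_mem _
    refine ⟨⟨v + w, add_mem hvG hwG⟩, ?_, rfl⟩
    -- `S(v + w) = Sv` lies in `SV ≤ Gᗮ`, so this inclusion needs no closedness.
    refine (V.B_apply_eq_iff lam _ 0).mpr (V.map_whole_pencil_le_orthogonal_G lam ⟨v, hvV, ?_⟩)
    simp [hw0]

/-! ### Fredholm property of `B` -/

theorem finiteDimensional_ker_B (V : a.DenseClosedSubspace) (lam : ℝ)
    (hN : (lam : ℂ) ∉ essSpectrum a.neumann) (hD : (lam : ℂ) ∉ essSpectrum V.dirichlet) :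
    FiniteDimensional ℂ (V.B lam).ker := by
  have : FiniteDimensional ℂ (opKer a.neumann lam) := (not_not.mp hN).1
  have : FiniteDimensional ℂ (opKer V.dirichlet lam) := (not_not.mp hD).1
  have h : FiniteDimensional ℂ (V.G0 lam) := by
    rw [V.G0_eq_sup lam fun h => hN h.1]
    infer_instance
  unfold G0 at h
  exact (Submodule.equivMapOfInjective ((a.incl : a.H1 →ₗ[ℂ] H) ∘ₗ (V.G lam).subtype)
    (a.incl_injective.comp Subtype.val_injective) (V.B lam).ker).symm.finiteDimensional

/-- For `g ∈ G` in a subspace of finite codimension, `g = Sw` and `Pg = PSv` with `v ∈ V`. Then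
`PS(w - v) = 0` puts `w - v` in `G`, and `S(w - v) - g = -Sv ∈ Gᗮ` gives `B(w - v) = g`. -/
theorem cofg_range_B (V : a.DenseClosedSubspace) (lam : ℝ)
    (hN : (lam : ℂ) ∉ essSpectrum a.neumann) (hD : (lam : ℂ) ∉ essSpectrum V.dirichlet) :
    (V.B lam).range.CoFG := by
  have h1 := a.whole.cofg_range_pencil hN
  have h2 := (V.cofg_range_pencil hD).comap
    (V.toSubmodule.starProjection : a.H1 →ₗ[ℂ] a.H1)
  refine ((h1.inf h2).comap (V.G lam).subtype).of_le ?_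
  rintro g ⟨⟨w, hw⟩, v, hv⟩
  have hw' : a.whole.pencil lam w = g := hw
  have hv' : V.pencil lam v = V.toSubmodule.starProjection g := hv
  have hvV : v ∈ V.toSubmodule :=
    V.mem_of_pencil_mem (z := lam) (hv' ▸ Submodule.starProjection_apply_mem _ _)
  have hG : w - v ∈ V.G lam := by
    rw [mem_G_iff_whole_pencil, ← Submodule.starProjection_apply_eq_zero_iff, map_sub, map_sub,
      starProjection_whole_pencil_of_mem V _ hvV, hw', hv', sub_self]
  refine ⟨⟨w - v, hG⟩, ?_⟩
  refine (V.B_apply_eq_iff lam _ g).mpr (V.map_whole_pencil_le_orthogonal_G lam ⟨-v, ?_, ?_⟩)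
  · exact neg_mem hvV
  · simp [hw']

theorem isClosed_range_B (V : a.DenseClosedSubspace) (lam : ℝ)
    (h : (V.B lam).range.CoFG) [FiniteDimensional ℂ (V.B lam).ker] :
    IsClosed ((V.B lam).range : Set (V.G lam)) := by
  have hG : IsClosed (V.G lam : Set a.H1) := by
    rw [G_eq_orthogonal_map]
    exact Submodule.isClosed_orthogonal _
  have := hG.completeSpace_coe
  -- The range is the image of the whole space: `T = L = B`, `Q = I`.
  have h1 := ContinuousLinearMap.isClosed_map_of_eqOn_comp (V.B lam) (V.B lam)
    (ContinuousLinearMap.id ℂ _) h (V := ⊤) isClosed_univ fun _ _ => rfl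
  rwa [Submodule.map_top] at h1

theorem zero_notMem_essSpectrumB (V : a.DenseClosedSubspace) (lam : ℝ)
    (hN : (lam : ℂ) ∉ essSpectrum a.neumann) (hD : (lam : ℂ) ∉ essSpectrum V.dirichlet) :
    (0 : ℂ) ∉ V.essSpectrumB lam := by
  have hker := V.finiteDimensional_ker_B lam hN hD
  have hcofg := V.cofg_range_B lam hN hD
  have hker' : opKer ((V.B lam : V.G lam →ₗ[ℂ] V.G lam).toPMap ⊤) 0 = (V.B lam).ker := by
    ext x
    rw [mem_opKer_iff, LinearPMap.mem_graph_iff, zero_smul]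
    exact ⟨fun ⟨y, (hy : (y : V.G lam) = x), h0⟩ => hy ▸ h0, fun h0 => ⟨⟨x, trivial⟩, rfl, h0⟩⟩
  have hrange : opRange ((V.B lam : V.G lam →ₗ[ℂ] V.G lam).toPMap ⊤) 0 = (V.B lam).range := by
    rw [opRange, zero_smul, sub_zero]
    ext x
    exact ⟨fun ⟨y, hy⟩ => ⟨y, hy⟩, fun ⟨y, hy⟩ => ⟨⟨y, trivial⟩, hy⟩⟩
  refine not_not.mpr ?_
  rw [hker', hrange]
  exact ⟨hker, V.isClosed_range_B lam hcofg, hcofg⟩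

end DenseClosedSubspace

end ClosedPositiveForm

theorem mainTheorem6 {H : Type*} [NormedAddCommGroup H] [InnerProductSpace ℂ H] [CompleteSpace H]
    [TopologicalSpace.SeparableSpace H] (hH : ¬ FiniteDimensional ℂ H)
    (a : ClosedPositiveForm H) (V : a.DenseClosedSubspace) (lam : ℝ) :
    ((lam : ℂ) ∉ essSpectrum a.neumann ∩ essSpectrum V.dirichlet →
      V.G0 lam = (V.ED lam).range ⊔ (a.EN lam).range) ∧
    ((lam : ℂ) ∉ essSpectrum a.neumann ∪ essSpectrum V.dirichlet →
      (0 : ℂ) ∉ V.essSpectrumB lam) := by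
  refine ⟨fun h => ?_, fun h => ?_⟩
  · rw [V.G0_eq_sup lam h, ClosedPositiveForm.DenseClosedSubspace.ED, ClosedPositiveForm.EN,
      Submodule.range_starProjection, Submodule.range_starProjection]
  · exact V.zero_notMem_essSpectrumB lam (fun hN => h (.inl hN)) fun hD => h (.inr hD)
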